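/- Let $r\ge 4$. An $r$-graph $G=(V,E)$ consists of a finite vertex set $V$ and a set $E$ of $r$-element subsets of $V$. It contains a clique of order $k$ if there is a $k$-element set $S\subseteq V$ all of whose $r$-element subsets belong to $E$. The Lagrangian of $G$ is $$\lambda(G)=\max\Big\{\sum_{e\in E}\ \prod_{i\in e}x_i \;:\; x_i\ge 0\ \text{for all } i\in V,\ \sum_{i\in V}x_i=1\Big\}.$$ Let $[n]^{(r)}$ denote the $r$-graph on $\{1,\dots,n\}$ whose edges are all $r$-element subsets. Let $t\geq 1$ and $m$ be integers with $$\binom{t-1}{r}\le m\le \binom{t-1}{r}+\binom{t-2}{r-1}-\Big[(2r-6)\,2^{r-1}+2^{r-3}+(r-4)(2r-7)-1\Big]\left(\binom{t-2}{r-2}-1\right).$$ If $G$ is an $r$-graph with $t$ vertices and $m$ edges that contains no clique of order $t-1$, then $$\lambda(G)<\lambda\big([t-1]^{(r)}\big).$$ -/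

import Mathlib

/-- An `r`-uniform hypergraph on the vertex set `V`: a finite family of `r`-subsets of `V`. -/
structure UniformHypergraph (r : ℕ) (V : Type*) where
  edges : Finset (Finset V)
  card_of_mem : ∀ e ∈ edges, e.card = r

namespace UniformHypergraph

/-- The complete `r`-graph on the vertex set `V`; with `V = Fin n` it is `[n]^{(r)}`. -/
def complete (r : ℕ) (V : Type*) [Fintype V] : UniformHypergraph r V where
  edges := Finset.powersetCard r Finset.univ
  card_of_mem := fun _ he => (Finset.mem_powersetCard.mp he).2

/-- `G` contains a clique of order `k`: some `k` vertices all of whose `r`-subsets are edges. -/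
def ContainsClique {r : ℕ} {V : Type*} (G : UniformHypergraph r V) (k : ℕ) : Prop :=
  ∃ S : Finset V, S.card = k ∧ ∀ e : Finset V, e ⊆ S → e.card = r → e ∈ G.edges

/-- The polynomial `λ(G, x)`: the sum over the edges of the products of the vertex weights. -/
noncomputable def weight {r : ℕ} {V : Type*} (G : UniformHypergraph r V) (x : V → ℝ) : ℝ :=
  ∑ e ∈ G.edges, ∏ i ∈ e, x i

/-- The Lagrangian `λ(G)`: the maximum of `λ(G, x)` over the standard simplex
(nonnegative weights of total `1`). -/
noncomputable def lagrangian {r : ℕ} {V : Type*} [Fintype V] (G : UniformHypergraph r V) : ℝ :=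
  sSup (G.weight '' stdSimplex ℝ V)

/-- The supremum in the definition of the Lagrangian is a maximum. -/
theorem isGreatest_lagrangian {r : ℕ} {V : Type*} [Fintype V] [Nonempty V]
    (G : UniformHypergraph r V) : IsGreatest (G.weight '' stdSimplex ℝ V) G.lagrangian := by
  classical
  have hc : Continuous G.weight := by
    unfold weight
    fun_prop
  have hne : (stdSimplex ℝ V).Nonempty :=
    ⟨Pi.single (Classical.arbitrary V) 1, single_mem_stdSimplex ℝ _⟩
  exact ((isCompact_stdSimplex ℝ V).image hc).isGreatest_sSup (hne.image _)

end UniformHypergraph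

/-! Put n = t - 1 and suppose λ(G) ≥ C(n,r)/n^r, the value of the uniform weighting on [n]^(r). Take
a maximal weighting x. If some x_v = 0, Maclaurin's inequality on the other n vertices, together
with a missing edge there, gives λ(G) < C(n,r)/n^r (`weight_lt_of_eq_zero`).

Otherwise every link in G weighs at least rλ(G), while Maclaurin bounds the links of the complete
r-graph. Hence the missing edges have light links: after scaling x by n, at most D·f(v), where D =
C(t-2,r-2) and f(v) = 1 - n/(r-1)·(1-(1-x_v)^(r-1)) (`nonedge_link_le`). The defects f are
nonnegative, 1 - f(v) ≤ n·x_v, and their sum is about r/2 (`sum_defect_le`). So only few vertices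
have a large defect, and double counting bounds the number of missing edges by a constant times D
(`card_le_of_link_le`). The upper bound on m demands more missing edges than that. -/

open Finset

/-! ### Maclaurin's inequality and complete r-graphs. -/

/-- Tangent line inequality for `y ↦ y ^ (k + 1)` on the nonnegative reals. -/
theorem tangent_le_pow_succ (k : ℕ) {a y : ℝ} (ha : 0 ≤ a) (hy : 0 ≤ y) :
    a ^ (k + 1) + (k + 1) * a ^ k * (y - a) ≤ y ^ (k + 1) := by
  induction k with
  | zero => simp
  | succ k ih =>
    have h1 := mul_le_mul_of_nonneg_left ih hy
    have h2 : 0 ≤ ((k : ℝ) + 1) * a ^ k * (y - a) ^ 2 := by positivity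
    calc _ = y * (a ^ (k + 1) + (k + 1) * a ^ k * (y - a)) - (k + 1) * a ^ k * (y - a) ^ 2 := by
          push_cast; ring
      _ ≤ y * y ^ (k + 1) := by linarith
      _ = _ := by ring

/-- Induction step for Maclaurin: adjoining a weight a to n weights of mean μ. By Pascal's rule the
left side is the tangent at μ of C(n+1,k+1)·y^(k+1), evaluated at the new mean. -/
theorem choose_mul_pow_add_le (n k : ℕ) {a μ : ℝ} (ha : 0 ≤ a) (hμ : 0 ≤ μ) :
    (n.choose (k + 1) : ℝ) * μ ^ (k + 1) + a * (n.choose k * μ ^ k) ≤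
      (n + 1).choose (k + 1) * ((a + n * μ) / ((n + 1 : ℕ) : ℝ)) ^ (k + 1) := by
  have hT := tangent_le_pow_succ k hμ (y := (a + n * μ) / ((n + 1 : ℕ) : ℝ)) (by positivity)
  have hch : ((n + 1 : ℕ) : ℝ) * (n.choose k : ℝ) = (n + 1).choose (k + 1) * (k + 1) := by
    exact_mod_cast Nat.add_one_mul_choose_eq n k
  have hpas : ((n + 1).choose (k + 1) : ℝ) = n.choose k + n.choose (k + 1) := by
    exact_mod_cast Nat.choose_succ_succ n k
  have hh : ((n + 1 : ℕ) : ℝ) * ((a + n * μ) / ((n + 1 : ℕ) : ℝ) - μ) = a - μ := by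
    rw [mul_sub, mul_div_cancel₀ _ (by positivity)]; push_cast; ring
  generalize (a + n * μ) / ((n + 1 : ℕ) : ℝ) = y at *
  calc _ = (n + 1).choose (k + 1) * μ ^ (k + 1) + n.choose k * μ ^ k * (a - μ) := by
        rw [hpas]; ring
    _ = (n + 1).choose (k + 1) * (μ ^ (k + 1) + (k + 1) * μ ^ k * (y - μ)) := by
        rw [← hh]; linear_combination μ ^ k * (y - μ) * hch
    _ ≤ _ := by gcongr

/-- Maclaurin's inequality between the `k`-th elementary symmetric polynomial and the mean. -/
theorem sum_prod_powersetCard_le {V : Type*} [DecidableEq V] (S : Finset V) (x : V → ℝ)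
    (hx : ∀ i ∈ S, 0 ≤ x i) (k : ℕ) :
    ∑ e ∈ powersetCard k S, ∏ i ∈ e, x i ≤ (#S).choose k * ((∑ i ∈ S, x i) / #S) ^ k := by
  induction S using Finset.induction_on generalizing k with
  | empty =>
    cases k with
    | zero => simp
    | succ k => rw [powersetCard_eq_empty.mpr (by simp)]; simp
  | insert a S ha ih =>
    have hxS : ∀ i ∈ S, 0 ≤ x i := fun i hi => hx i (mem_insert_of_mem hi)
    have hxa : 0 ≤ x a := hx a (mem_insert_self a S)
    cases k with
    | zero => simp
    | succ k =>
      have hdisj : Disjoint (powersetCard (k + 1) S) ((powersetCard k S).image (insert a)) := by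
        rw [disjoint_left]
        intro e he he'
        obtain ⟨e', -, rfl⟩ := mem_image.mp he'
        exact ha ((mem_powersetCard.mp he).1 (mem_insert_self a e'))
      have hnot : ∀ e ∈ powersetCard k S, a ∉ e :=
        fun e he h => ha ((mem_powersetCard.mp he).1 h)
      rw [powersetCard_succ_insert ha, sum_union hdisj, sum_image]
      swap
      · intro e he e' he' h
        rw [← erase_insert (hnot e he), ← erase_insert (hnot e' he')]
        exact congrArg (fun s => s.erase a) h
      rw [sum_congr rfl fun e he => prod_insert (hnot e he), ← mul_sum, sum_insert ha,
        card_insert_of_notMem ha]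
      have hs0 : 0 ≤ ∑ i ∈ S, x i := sum_nonneg hxS
      have hμ0 : 0 ≤ (∑ i ∈ S, x i) / #S := by positivity
      have hsμ : ∑ i ∈ S, x i = #S * ((∑ i ∈ S, x i) / #S) := by
        rcases S.eq_empty_or_nonempty with rfl | h
        · simp
        · rw [mul_div_cancel₀ _ (by exact_mod_cast h.card_pos.ne')]
      have hstep := choose_mul_pow_add_le (#S) k hxa hμ0
      rw [← hsμ] at hstep
      refine le_trans ?_ hstep
      gcongr
      · exact ih hxS (k + 1)
      · exact ih hxS k

/-- The Lagrangians of complete `r`-graphs strictly increase with the order. -/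
theorem choose_div_pow_lt {n r : ℕ} (hr : 2 ≤ r) (hrn : r ≤ n + 1) :
    (n.choose r : ℝ) / (n : ℝ) ^ r < ((n + 1).choose r : ℝ) / ((n + 1 : ℕ) : ℝ) ^ r := by
  obtain ⟨j, rfl⟩ := Nat.exists_eq_add_of_le' hr
  have hn : (0 : ℝ) < n := by exact_mod_cast (show 0 < n by omega)
  have hC : 0 < ((n + 1).choose (j + 2) : ℝ) := by exact_mod_cast Nat.choose_pos hrn
  have h1 : (n.choose (j + 2) : ℝ) * (n + 1) = (n + 1).choose (j + 2) * (n - 1 - j) := by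
    have h := Nat.choose_mul_succ_eq n (j + 2)
    have h' : (((n + 1 - (j + 2) : ℕ)) : ℝ) = n - 1 - j := by
      rw [Nat.cast_sub hrn]; push_cast; ring
    rw [← h']
    exact_mod_cast h
  have hT := mul_le_mul_of_nonneg_left
    (tangent_le_pow_succ j (a := (n : ℝ) + 1) (y := n) (by positivity) hn.le) hn.le
  -- Tangent at n + 1 evaluated at n; the discarded term `hp` gives strictness.
  have hkey : ((n : ℝ) - 1 - j) * (n + 1) ^ (j + 1) < n ^ (j + 2) := by
    have hp : 0 < ((n : ℝ) + 1) ^ j * (j + 1) := by positivity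
    calc _ = n * (((n : ℝ) + 1) ^ (j + 1) + (j + 1) * (n + 1) ^ j * (n - (n + 1)))
          - (n + 1) ^ j * (j + 1) := by ring
      _ < n * (n : ℝ) ^ (j + 1) := by linarith
      _ = _ := by ring
  rw [div_lt_div_iff₀ (by positivity) (by positivity)]
  push_cast
  calc (n.choose (j + 2) : ℝ) * (n + 1) ^ (j + 2)
      = (n.choose (j + 2) * (n + 1)) * (n + 1) ^ (j + 1) := by ring
    _ = (n + 1).choose (j + 2) * ((n - 1 - j) * (n + 1) ^ (j + 1)) := by rw [h1]; ring
    _ < _ := by gcongr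

/-! ### Counting missing edges. -/

/-- Counting a family of `r`-sets whose weighted links are small: sets with at most one vertex of
large `f` are controlled by the links, the others contain a pair of such vertices. -/
theorem card_le_of_link_le {V : Type*} [Fintype V] [DecidableEq V] {r : ℕ} (hr : 2 ≤ r)
    (N : Finset (Finset V)) (hN : ∀ e ∈ N, #e = r) (f y : V → ℝ) {D q : ℝ} (hq : 0 ≤ q)
    (hy : ∀ v, 0 ≤ y v) (hfy : ∀ v, 1 - f v ≤ y v)
    (hlink : ∀ v, ∑ e ∈ N with v ∈ e, ∏ i ∈ e.erase v, y i ≤ D * f v) :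
    (#N : ℝ) * q ^ (r - 1) ≤ D * ∑ v, f v + q ^ (r - 1) *
      ((#{v | 1 - q < f v}).choose 2 * (Fintype.card V - 2).choose (r - 2) : ℕ) := by
  set B : Finset V := {v | 1 - q < f v} with hB
  have hsplit := card_filter_add_card_filter_not (s := N) (fun e => #(e ∩ B) ≤ 1)
  have htwo : #{e ∈ N | ¬ #(e ∩ B) ≤ 1} ≤
      (#B).choose 2 * (Fintype.card V - 2).choose (r - 2) := by
    have hsub : ({e ∈ N | ¬ #(e ∩ B) ≤ 1} : Finset (Finset V)) ⊆ (powersetCard 2 B).biUnion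
        fun p => (powersetCard (r - 2) (univ \ p)).image (p ∪ ·) := by
      intro e he
      obtain ⟨heN, he2⟩ := mem_filter.mp he
      obtain ⟨p, hp, hp2⟩ := exists_subset_card_eq (show 2 ≤ #(e ∩ B) by omega)
      have hpe : p ⊆ e := hp.trans inter_subset_left
      refine mem_biUnion.mpr ⟨p, mem_powersetCard.mpr ⟨hp.trans inter_subset_right, hp2⟩,
        mem_image.mpr ⟨e \ p, mem_powersetCard.mpr ⟨sdiff_subset_sdiff (subset_univ e) le_rfl, ?_⟩,
          union_sdiff_of_subset hpe⟩⟩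
      rw [card_sdiff_of_subset hpe, hN e heN, hp2]
    refine (card_le_card hsub).trans (card_biUnion_le.trans ?_)
    rw [← card_powersetCard, ← smul_eq_mul]
    refine sum_le_card_nsmul _ _ _ fun p hp => card_image_le.trans ?_
    rw [card_powersetCard, card_sdiff_of_subset (subset_univ p), card_univ,
      (mem_powersetCard.mp hp).2]
  have hone : (#{e ∈ N | #(e ∩ B) ≤ 1} : ℝ) * q ^ (r - 1) ≤ D * ∑ v, f v := by
    rw [← nsmul_eq_mul]
    calc _ ≤ ∑ e ∈ N with #(e ∩ B) ≤ 1, ∑ v ∈ e, ∏ i ∈ e.erase v, y i := by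
          refine card_nsmul_le_sum _ _ _ fun e he => ?_
          obtain ⟨heN, he1⟩ := mem_filter.mp he
          have hcard := hN e heN
          -- Distinguish the only vertex of large defect, if there is one; every other factor is
          -- then at least q.
          obtain ⟨v, hv, hgood⟩ : ∃ v ∈ e, ∀ i ∈ e.erase v, i ∉ B := by
            by_cases hemp : (e ∩ B).Nonempty
            · obtain ⟨v, hv⟩ := hemp
              refine ⟨v, (mem_inter.mp hv).1, fun i hi hiB => ?_⟩
              exact (mem_erase.mp hi).1 (card_le_one.mp he1 i
                (mem_inter.mpr ⟨(mem_erase.mp hi).2, hiB⟩) v hv)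
            · obtain ⟨v, hv⟩ := card_pos.mp (show 0 < #e by omega)
              exact ⟨v, hv, fun i hi hiB => hemp ⟨i, mem_inter.mpr ⟨(mem_erase.mp hi).2, hiB⟩⟩⟩
          calc q ^ (r - 1) = ∏ _i ∈ e.erase v, q := by
                rw [prod_const, card_erase_of_mem hv, hcard]
            _ ≤ ∏ i ∈ e.erase v, y i := by
                refine prod_le_prod (fun _ _ => hq) fun i hi => ?_
                have : ¬ 1 - q < f i := fun h => hgood i hi (by simpa [hB] using h)
                linarith [hfy i]
            _ ≤ _ := single_le_sum (f := fun v => ∏ i ∈ e.erase v, y i)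
                (fun v _ => prod_nonneg fun i _ => hy i) hv
      _ ≤ ∑ e ∈ N, ∑ v ∈ e, ∏ i ∈ e.erase v, y i :=
          sum_le_sum_of_subset_of_nonneg (filter_subset _ _)
            fun e _ _ => sum_nonneg fun v _ => prod_nonneg fun i _ => hy i
      _ = ∑ v, ∑ e ∈ N with v ∈ e, ∏ i ∈ e.erase v, y i := by
          refine sum_comm' fun e v => ?_
          simp
      _ ≤ ∑ v, D * f v := sum_le_sum fun v _ => hlink v
      _ = _ := (mul_sum _ _ _).symm
  have htwo' : (#{e ∈ N | ¬ #(e ∩ B) ≤ 1} : ℝ) ≤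
      ((#B).choose 2 * (Fintype.card V - 2).choose (r - 2) : ℕ) := by exact_mod_cast htwo
  rw [← hsplit, Nat.cast_add, add_mul]
  have := mul_le_mul_of_nonneg_left htwo' (pow_nonneg hq (r - 1))
  linarith

/-! ### First-order conditions at a maximal weighting. -/

/-- Second order Bonferroni bound for `(1 - x) ^ k`. -/
theorem one_sub_pow_le (k : ℕ) {x : ℝ} (h0 : 0 ≤ x) (h1 : x ≤ 1) :
    (1 - x) ^ k ≤ 1 - k * x + k * (k - 1) / 2 * x ^ 2 := by
  induction k with
  | zero => simp
  | succ k ih =>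
    have hB : 1 - k * x ≤ (1 - x) ^ k := by
      have := one_add_mul_le_pow (show (-2 : ℝ) ≤ -x by linarith) k
      rwa [mul_neg, ← sub_eq_add_neg, ← sub_eq_add_neg] at this
    have := mul_le_mul_of_nonneg_left hB h0
    calc (1 - x) ^ (k + 1) = (1 - x) ^ k - x * (1 - x) ^ k := by ring
      _ ≤ (1 - k * x + k * (k - 1) / 2 * x ^ 2) - x * (1 - k * x) := by linarith
      _ = _ := by push_cast; ring

/-- The link of `v` in the complete `(k + 1)`-graph. -/
theorem sum_link_powersetCard {V : Type*} [Fintype V] [DecidableEq V] (k : ℕ) (v : V)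
    (x : V → ℝ) :
    ∑ e ∈ powersetCard (k + 1) univ with v ∈ e, ∏ i ∈ e.erase v, x i =
      ∑ e ∈ powersetCard k (univ.erase v), ∏ i ∈ e, x i := by
  refine sum_nbij' (fun e => e.erase v) (fun e => insert v e) ?_ ?_ ?_ ?_ ?_
  · intro e he
    obtain ⟨he, hv⟩ := mem_filter.mp he
    refine mem_powersetCard.mpr ⟨erase_subset_erase v (subset_univ e), ?_⟩
    rw [card_erase_of_mem hv, (mem_powersetCard.mp he).2, Nat.add_sub_cancel]
  · intro e he
    obtain ⟨he, hc⟩ := mem_powersetCard.mp he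
    have hv : v ∉ e := fun h => by simpa using he h
    refine mem_filter.mpr ⟨mem_powersetCard.mpr ⟨subset_univ _, ?_⟩, mem_insert_self v e⟩
    rw [card_insert_of_notMem hv, hc]
  · intro e he
    exact insert_erase (mem_filter.mp he).2
  · intro e he
    exact erase_insert fun h => by simpa using (mem_powersetCard.mp he).1 h
  · intro e he
    rfl

namespace UniformHypergraph

variable {r : ℕ} {V : Type*}

theorem weight_nonneg (G : UniformHypergraph r V) {x : V → ℝ} (hx : ∀ i, 0 ≤ x i) :
    0 ≤ G.weight x :=
  sum_nonneg fun _ _ => prod_nonneg fun i _ => hx i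

theorem weight_smul (G : UniformHypergraph r V) (c : ℝ) (x : V → ℝ) :
    G.weight (c • x) = c ^ r * G.weight x := by
  unfold weight
  rw [mul_sum]
  refine sum_congr rfl fun e he => ?_
  simp only [Pi.smul_apply, smul_eq_mul]
  rw [prod_mul_distrib, prod_const, G.card_of_mem e he]

theorem weight_le_mul_sum_pow [Fintype V] (G : UniformHypergraph r V) (hr : r ≠ 0) {lam : ℝ}
    (hmax : ∀ y ∈ stdSimplex ℝ V, G.weight y ≤ lam) {z : V → ℝ} (hz : ∀ i, 0 ≤ z i) :
    G.weight z ≤ lam * (∑ i, z i) ^ r := by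
  rcases (sum_nonneg fun i _ => hz i : 0 ≤ ∑ i, z i).eq_or_lt with h | h
  · have hz0 : z = (0 : ℝ) • z := by
      funext i
      simpa using (sum_eq_zero_iff_of_nonneg fun i _ => hz i).mp h.symm i (mem_univ i)
    rw [hz0, weight_smul, ← hz0, ← h, zero_pow hr]
    simp
  · have hy : (∑ i, z i)⁻¹ • z ∈ stdSimplex ℝ V := by
      refine ⟨fun i => mul_nonneg (inv_nonneg.mpr h.le) (hz i), ?_⟩
      simp only [Pi.smul_apply, smul_eq_mul]
      rw [← mul_sum, inv_mul_cancel₀ h.ne']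
    have h1 := hmax _ hy
    rw [weight_smul, inv_pow, inv_mul_le_iff₀ (by positivity)] at h1
    linarith

theorem weight_update_sub [DecidableEq V] (G : UniformHypergraph r V) (x : V → ℝ) (v : V)
    (s : ℝ) : G.weight (Function.update x v (x v - s)) =
      G.weight x - s * ∑ e ∈ G.edges with v ∈ e, ∏ i ∈ e.erase v, x i := by
  unfold weight
  rw [sum_filter, mul_sum, ← sum_sub_distrib]
  refine sum_congr rfl fun e _ => ?_
  split_ifs with hv
  · rw [← mul_prod_erase e _ hv, ← mul_prod_erase e x hv, Function.update_self,
      prod_congr rfl fun i hi => Function.update_of_ne (mem_erase.mp hi).1 _ _]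
    ring
  · rw [prod_congr rfl fun i hi => Function.update_of_ne (fun h : i = v => hv (h ▸ hi)) _ _]
    ring

/-- First order condition at a maximum of the weight polynomial. -/
theorem mul_weight_le_link [Fintype V] [DecidableEq V] (G : UniformHypergraph r V) (hr : r ≠ 0)
    {x : V → ℝ} (hx : x ∈ stdSimplex ℝ V) (hmax : ∀ y ∈ stdSimplex ℝ V, G.weight y ≤ G.weight x)
    {v : V} (hv : 0 < x v) :
    r * G.weight x ≤ ∑ e ∈ G.edges with v ∈ e, ∏ i ∈ e.erase v, x i := by
  set lam := G.weight x
  set B := ∑ e ∈ G.edges with v ∈ e, ∏ i ∈ e.erase v, x i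
  have hlam : 0 ≤ lam := G.weight_nonneg hx.1
  have hxv : x v ≤ 1 := hx.2 ▸ single_le_sum (fun i _ => hx.1 i) (mem_univ v)
  have hr1 : (1 : ℝ) ≤ r := by exact_mod_cast Nat.one_le_iff_ne_zero.mpr hr
  by_contra! hlt
  set M := lam * (r * (r - 1) / 2)
  have hM : 0 ≤ M := mul_nonneg hlam (by nlinarith)
  -- Lowering x_v by s and using homogeneity gives λ - sB ≤ λ(1-s)^r. This s is small enough for the
  -- quadratic error s²M to stay below s(rλ - B).
  set s := min (x v) ((r * lam - B) / (M + 1))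
  have hs : 0 < s := lt_min hv (div_pos (by linarith) (by linarith))
  have hsv : s ≤ x v := min_le_left _ _
  have hs2 : s * (M + 1) ≤ r * lam - B := by
    rw [← le_div_iff₀ (by linarith)]; exact min_le_right _ _
  have h1 := G.weight_le_mul_sum_pow hr hmax (z := Function.update x v (x v - s)) fun i => by
    by_cases h : i = v
    · subst h; simpa using hsv
    · simpa [h] using hx.1 i
  rw [weight_update_sub, sum_update_of_mem (mem_univ v)] at h1
  have h2 : x v - s + ∑ i ∈ univ \ {v}, x i = 1 - s := by
    have := sum_sdiff (f := x) (subset_univ {v})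
    rw [sum_singleton, hx.2] at this
    linarith
  rw [h2] at h1
  have h3 := mul_le_mul_of_nonneg_left (one_sub_pow_le r hs.le (hsv.trans hxv)) hlam
  have h4 : s * (r * lam - B) ≤ s * (s * M) := by
    have : lam * (1 - r * s + r * (r - 1) / 2 * s ^ 2) = lam - s * (r * lam) + s * (s * M) := by
      simp only [M]; ring
    change lam - s * B ≤ _ at h1
    linarith
  have h5 := le_of_mul_le_mul_left h4 hs
  linarith

/-- In a maximal weighting of value at least that of `[n]^{(r)}`, the links formed by the missing
edges are light. -/
theorem nonedge_link_le [Fintype V] [DecidableEq V] {j p : ℕ} (hV : Fintype.card V = j + p + 2)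
    (G : UniformHypergraph (j + 2) V) {x : V → ℝ} (hx : x ∈ stdSimplex ℝ V)
    (hmax : ∀ y ∈ stdSimplex ℝ V, G.weight y ≤ G.weight x)
    (hL : ((j + p + 1).choose (j + 2) : ℝ) / ((j + p + 1 : ℕ) : ℝ) ^ (j + 2) ≤ G.weight x)
    {v : V} (hv : 0 < x v) :
    ∑ e ∈ powersetCard (j + 2) univ \ G.edges with v ∈ e,
        ∏ i ∈ e.erase v, (((j + p + 1 : ℕ) : ℝ) * x i) ≤
      (j + p).choose j * (1 - ((j + p + 1 : ℕ) : ℝ) / (j + 1) * (1 - (1 - x v) ^ (j + 1))) := by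
  have hE : G.edges ⊆ powersetCard (j + 2) univ := fun e he =>
    mem_powersetCard.mpr ⟨subset_univ e, G.card_of_mem e he⟩
  have hfirst := G.mul_weight_le_link (by omega) hx hmax hv
  have hmac := sum_prod_powersetCard_le (univ.erase v) x (fun i _ => hx.1 i) (j + 1)
  have hsum : ∑ i ∈ univ.erase v, x i = 1 - x v := by
    rw [← hx.2, ← add_sum_erase univ x (mem_univ v)]; ring
  rw [hsum, card_erase_of_mem (mem_univ v), card_univ, hV, ← sum_link_powersetCard] at hmac
  have hsplit : ∑ e ∈ powersetCard (j + 2) univ \ G.edges with v ∈ e, ∏ i ∈ e.erase v, x i +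
      ∑ e ∈ G.edges with v ∈ e, ∏ i ∈ e.erase v, x i =
      ∑ e ∈ powersetCard (j + 2) univ with v ∈ e, ∏ i ∈ e.erase v, x i := by
    rw [sum_filter, sum_filter, sum_filter, sum_sdiff hE]
  have hscale : ∑ e ∈ powersetCard (j + 2) univ \ G.edges with v ∈ e,
        ∏ i ∈ e.erase v, (((j + p + 1 : ℕ) : ℝ) * x i) = ((j + p + 1 : ℕ) : ℝ) ^ (j + 1) *
      ∑ e ∈ powersetCard (j + 2) univ \ G.edges with v ∈ e, ∏ i ∈ e.erase v, x i := by
    rw [mul_sum]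
    refine sum_congr rfl fun e he => ?_
    obtain ⟨he, hve⟩ := mem_filter.mp he
    rw [prod_mul_distrib, prod_const, card_erase_of_mem hve,
      (mem_powersetCard.mp (mem_sdiff.mp he).1).2]
    rfl
  rw [hscale]
  have h1 : ((j + p + 1 : ℕ) : ℝ) * (j + p).choose j = (j + p + 1).choose (j + 1) * (j + 1) := by
    exact_mod_cast Nat.add_one_mul_choose_eq (j + p) j
  have h2 : ((j + p + 1).choose (j + 2) : ℝ) * (j + 2) = (j + p + 1).choose (j + 1) * p := by
    have := Nat.choose_succ_right_eq (j + p + 1) (j + 1)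
    rw [show j + p + 1 - (j + 1) = p by omega] at this
    exact_mod_cast this
  change _ ≤ ((j + p + 1).choose (j + 1) : ℝ) * ((1 - x v) / ((j + p + 1 : ℕ) : ℝ)) ^ (j + 1)
    at hmac
  have hn : (0 : ℝ) < ((j + p + 1 : ℕ) : ℝ) := by positivity
  have hnp : ((j + p + 1 : ℕ) : ℝ) = j + 1 + p := by push_cast; ring
  set n : ℝ := ((j + p + 1 : ℕ) : ℝ)
  set C : ℝ := ((j + p + 1).choose (j + 1) : ℝ)
  -- The assumed lower bound on λ, rewritten as a lower bound for the links in G.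
  have hlow : C * p / n ^ (j + 2) ≤ ((j + 2 : ℕ) : ℝ) * G.weight x := by
    rw [← h2, mul_comm, mul_div_assoc]
    push_cast
    gcongr
  have hd : ∑ e ∈ powersetCard (j + 2) univ \ G.edges with v ∈ e, ∏ i ∈ e.erase v, x i ≤
      C * ((1 - x v) / n) ^ (j + 1) - C * p / n ^ (j + 2) := by
    linarith
  calc _ ≤ n ^ (j + 1) * (C * ((1 - x v) / n) ^ (j + 1) - C * p / n ^ (j + 2)) := by gcongr
    _ = C * ((1 - x v) ^ (j + 1) - p / n) := by
        rw [div_pow]; field_simp; ring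
    _ = _ := by
        have : ((j + p).choose j : ℝ) = C * (j + 1) / n := by
          rw [← h1]; field_simp
        have hj : ((j : ℝ) + 1) ≠ 0 := by positivity
        rw [this]
        have hp : (p : ℝ) = n - (j + 1) := by linarith
        rw [hp]
        field_simp
        ring

end UniformHypergraph

/-! ### Weightings with a vanishing coordinate. -/

namespace UniformHypergraph

variable {r : ℕ} {V : Type*}

/-- Missing edges T inside the support set S can be added to G before Maclaurin is applied on S;
their weight is the gain. -/
theorem weight_le_of_eq_zero [Fintype V] [DecidableEq V] (G : UniformHypergraph r V) {x : V → ℝ}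
    (hx : x ∈ stdSimplex ℝ V) {S : Finset V} (hS : ∀ v ∉ S, x v = 0)
    {T : Finset (Finset V)} (hT : T ⊆ powersetCard r S) (hTG : Disjoint T G.edges) :
    G.weight x + ∑ e ∈ T, ∏ i ∈ e, x i ≤ ((#S).choose r : ℝ) / (#S : ℝ) ^ r := by
  have hmac := sum_prod_powersetCard_le S x (fun i _ => hx.1 i) r
  have hsum : ∑ i ∈ S, x i = 1 := by
    rw [← hx.2]
    exact sum_subset (subset_univ S) fun v _ hv => hS v hv
  rw [hsum, one_div, inv_pow, ← div_eq_mul_inv] at hmac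
  refine le_trans ?_ hmac
  have hw : G.weight x = ∑ e ∈ G.edges with e ⊆ S, ∏ i ∈ e, x i := by
    unfold weight
    refine (sum_filter_of_ne fun e _ hne => ?_).symm
    by_contra hsub
    obtain ⟨v, hve, hvS⟩ := not_subset.mp hsub
    exact hne (prod_eq_zero hve (hS v hvS))
  rw [hw, ← sum_union (hTG.symm.mono_left (filter_subset _ _))]
  refine sum_le_sum_of_subset_of_nonneg (union_subset (fun e he => ?_) hT)
    fun e _ _ => prod_nonneg fun i _ => hx.1 i
  obtain ⟨he, heS⟩ := mem_filter.mp he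
  exact mem_powersetCard.mpr ⟨heS, G.card_of_mem e he⟩

/-- A weighting with a vanishing coordinate is worse than the best one on a clique. -/
theorem weight_lt_of_eq_zero [Fintype V] [DecidableEq V] (G : UniformHypergraph r V) {n : ℕ}
    (hr : 2 ≤ r) (hrn : r ≤ n) (hV : Fintype.card V = n + 1) (hG : ¬ G.ContainsClique n)
    {x : V → ℝ} (hx : x ∈ stdSimplex ℝ V) {v : V} (hv : x v = 0) :
    G.weight x < (n.choose r : ℝ) / (n : ℝ) ^ r := by
  have hS : #(univ.erase v) = n := by
    rw [card_erase_of_mem (mem_univ v), card_univ, hV, Nat.add_sub_cancel]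
  have hzero : ∀ w ∉ univ.erase v, x w = 0 := fun w hw => by
    have : w = v := by simpa using hw
    rw [this, hv]
  obtain ⟨e, heS, her, heG⟩ : ∃ e, e ⊆ univ.erase v ∧ #e = r ∧ e ∉ G.edges := by
    by_contra! h
    exact hG ⟨univ.erase v, hS, h⟩
  -- If the missing edge meets a second zero, the support fits in n - 1 vertices; otherwise the edge
  -- itself has positive weight.
  by_cases hpos : ∃ w ∈ e, x w = 0
  · obtain ⟨w, hwe, hw⟩ := hpos
    obtain ⟨n, rfl⟩ := Nat.exists_eq_add_of_le' (show 1 ≤ n by omega)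
    have h := G.weight_le_of_eq_zero hx (S := (univ.erase v).erase w) (T := ∅) (fun u hu => by
      by_cases huw : u = w
      · rw [huw, hw]
      · exact hzero u fun h => hu (mem_erase.mpr ⟨huw, h⟩)) (empty_subset _) (by simp)
    rw [card_erase_of_mem (heS hwe), hS, sum_empty, add_zero, Nat.add_sub_cancel] at h
    exact h.trans_lt (choose_div_pow_lt hr hrn)
  · push Not at hpos
    have h := G.weight_le_of_eq_zero hx hzero (T := {e})
      (singleton_subset_iff.mpr (mem_powersetCard.mpr ⟨heS, her⟩)) (disjoint_singleton_left.mpr heG)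
    rw [hS, sum_singleton] at h
    have : 0 < ∏ i ∈ e, x i := prod_pos fun i hi => (hx.1 i).lt_of_ne' (hpos i hi)
    linarith

theorem choose_div_pow_le_lagrangian_complete {n : ℕ} (hn : n ≠ 0) (r : ℕ) :
    (n.choose r : ℝ) / (n : ℝ) ^ r ≤ (complete r (Fin n)).lagrangian := by
  have : NeZero n := ⟨hn⟩
  refine (isGreatest_lagrangian (complete r (Fin n))).2
    ⟨fun _ => (n : ℝ)⁻¹, ⟨fun _ => by positivity, ?_⟩, ?_⟩
  · rw [sum_const, card_univ, Fintype.card_fin, nsmul_eq_mul,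
      mul_inv_cancel₀ (by exact_mod_cast hn)]
  · unfold weight complete
    rw [sum_congr rfl fun e he => by rw [prod_const, (mem_powersetCard.mp he).2], sum_const,
      card_powersetCard, card_univ, Fintype.card_fin, nsmul_eq_mul, inv_pow, div_eq_mul_inv]

end UniformHypergraph

/-! ### The sum of the defects. -/

/-- If all defects `1 - n / k * (1 - (1 - x) ^ k)` are nonnegative then their sum is bounded. -/
theorem sum_defect_le {V : Type*} [Fintype V] {j p : ℕ} (hp : 0 < p)
    (hV : Fintype.card V = j + p + 2) {x : V → ℝ} (hx : x ∈ stdSimplex ℝ V)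
    (hf : ∀ v, 0 ≤ 1 - ((j + p + 1 : ℕ) : ℝ) / (j + 1) * (1 - (1 - x v) ^ (j + 1))) :
    ∑ v, (1 - ((j + p + 1 : ℕ) : ℝ) / (j + 1) * (1 - (1 - x v) ^ (j + 1))) ≤
      1 + j / 2 * (1 + (j + 1) / p) := by
  have hp' : (0 : ℝ) < p := by exact_mod_cast hp
  have hx1 : ∀ v, x v ≤ 1 := fun v => hx.2 ▸ single_le_sum (fun i _ => hx.1 i) (mem_univ v)
  -- f(v) ≥ 0 says (1-x_v)^(j+1) ≥ p/(j+1+p). Bernoulli for (1+x_v)^(j+1) and (1-x_v²)^(j+1) ≤ 1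
  -- turn this into p·x_v ≤ 1, which makes the quadratic Bonferroni term linear.
  have hxp : ∀ v, p * x v ≤ 1 := fun v => by
    have h0 := hx.1 v
    have h1 := hx1 v
    have hB := one_add_mul_le_pow (show (-2 : ℝ) ≤ x v by linarith) (j + 1)
    have hq : 0 ≤ (1 - x v) ^ (j + 1) := pow_nonneg (by linarith) _
    have hle : (1 - x v) ^ (j + 1) * (1 + x v) ^ (j + 1) ≤ 1 := by
      rw [← mul_pow]
      exact pow_le_one₀ (by nlinarith) (by nlinarith)
    have h2 := (mul_le_mul_of_nonneg_left hB hq).trans hle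
    have h3 : (p : ℝ) ≤ (1 - x v) ^ (j + 1) * (j + 1 + p) := by
      have := hf v
      rw [sub_nonneg, div_mul_eq_mul_div, div_le_one (by positivity)] at this
      push_cast at this
      linarith
    have h4 : (p : ℝ) * (1 + (j + 1) * x v) ≤ j + 1 + p := by
      have h5 : (0 : ℝ) ≤ 1 + (j + 1) * x v := by positivity
      calc _ ≤ (1 - x v) ^ (j + 1) * (j + 1 + p) * (1 + (j + 1) * x v) := by gcongr
        _ = ((1 - x v) ^ (j + 1) * (1 + ((j + 1 : ℕ) : ℝ) * x v)) * (j + 1 + p) := by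
            push_cast; ring
        _ ≤ 1 * (j + 1 + p) := by gcongr
        _ = _ := one_mul _
    have h6 : ((j : ℝ) + 1) * (p * x v) ≤ (j + 1) * 1 := by linarith
    exact le_of_mul_le_mul_left h6 (by positivity)
  have hterm : ∀ v, 1 - ((j + p + 1 : ℕ) : ℝ) / (j + 1) * (1 - (1 - x v) ^ (j + 1)) ≤
      1 - ((j + p + 1 : ℕ) : ℝ) * x v + ((j + p + 1 : ℕ) : ℝ) * (j / 2) / p * x v := fun v => by
    have h1 := one_sub_pow_le (j + 1) (hx.1 v) (hx1 v)
    have h2 : x v ^ 2 ≤ x v / p := by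
      rw [le_div_iff₀ hp']
      nlinarith [hxp v, hx.1 v]
    have h3 : (1 - x v) ^ (j + 1) ≤ 1 - (j + 1) * x v + (j + 1) * (j / 2) * (x v / p) := by
      push_cast at h1
      have : ((j : ℝ) + 1) * (j / 2) * x v ^ 2 ≤ (j + 1) * (j / 2) * (x v / p) := by gcongr
      linarith
    calc _ ≤ 1 - ((j + p + 1 : ℕ) : ℝ) / (j + 1) *
          (1 - (1 - (j + 1) * x v + (j + 1) * (j / 2) * (x v / p))) := by gcongr
      _ = _ := by field_simp; ring
  refine (sum_le_sum fun v _ => hterm v).trans_eq ?_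
  rw [sum_add_distrib, sum_sub_distrib, ← mul_sum, ← mul_sum, hx.2, sum_const, card_univ, hV,
    nsmul_eq_mul]
  push_cast
  field_simp
  ring

/-! ### Numerical contradictions. -/

/-- The case r = 4, c = 17. The threshold q = 4/7 still forces b ≤ 4, while (7/4)³ is small enough:
about 17.2·D missing edges at most, against 18D - 17 with D ≥ 35. With q = 1/2 the estimate would
fail. -/
theorem numeric_contradiction_four {b : ℕ} {N D S p : ℝ} (hp : 34 ≤ p) (hD : p + 1 ≤ D)
    (hS : S ≤ 1 + 2 / 2 * (1 + (2 + 1) / p)) (hb : b * (3 / 7) ≤ S)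
    (hcount : N * (4 / 7) ^ 3 ≤ D * S + (4 / 7) ^ 3 * (b.choose 2 * D))
    (hN : (17 + 1) * D - 17 ≤ N) : False := by
  have h3 : 3 / p ≤ 3 / 34 := by gcongr
  have hS' : S ≤ 2 + 3 / 34 := by
    have : (1 : ℝ) + 2 / 2 * (1 + (2 + 1) / p) = 2 + 3 / p := by ring
    linarith
  have hb4 : b ≤ 4 := by
    have : (b : ℝ) < 5 := by linarith
    have : b < 5 := by exact_mod_cast this
    omega
  have hch : (b.choose 2 : ℝ) ≤ 6 := by
    exact_mod_cast (Nat.choose_le_choose 2 hb4 : b.choose 2 ≤ Nat.choose 4 2)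
  have h1 : D * S ≤ D * (2 + 3 / 34) := mul_le_mul_of_nonneg_left hS' (by linarith)
  have h2 : (b.choose 2 : ℝ) * D ≤ 6 * D := mul_le_mul_of_nonneg_right hch (by linarith)
  linarith

theorem choose_two_le_two_pow (n : ℕ) : (n + 1).choose 2 ≤ 2 ^ n := by
  induction n with
  | zero => simp
  | succ n ih =>
    have h1 : (n + 1 + 1).choose 2 = (n + 1).choose 1 + (n + 1).choose 2 :=
      Nat.choose_succ_succ _ _
    have h2 : n < 2 ^ n := Nat.lt_two_pow_self
    rw [h1, Nat.choose_one_right, pow_succ]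
    omega

/-- Here r = i + 4 ≥ 5 and P = 2^(r-1). With q = 1/2 at most r vertices are bad, and C(r,2) ≤ P; so
c < P(i/2 + 13/4), against c ≥ (2i+2)P - 1. -/
theorem numeric_contradiction_of_five_le {i b : ℕ} {N D S p c : ℝ} (hi : 1 ≤ i)
    (hc : (2 * i + 2) * 2 ^ (i + 3) - 1 ≤ c) (hp : 2 / 3 * ((i + 3) * c) ≤ p) (hD : p + 1 ≤ D)
    (hS : S ≤ 1 + (i + 2) / 2 * (1 + (i + 2 + 1) / p)) (hb : b * (1 / 2) ≤ S)
    (hcount : N * (1 / 2) ^ (i + 3) ≤ D * S + (1 / 2) ^ (i + 3) * (b.choose 2 * D))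
    (hN : (c + 1) * D - c ≤ N) : False := by
  have hi' : (1 : ℝ) ≤ i := by exact_mod_cast hi
  have hP : (16 : ℝ) ≤ 2 ^ (i + 3) := by
    calc (16 : ℝ) = 2 ^ 4 := by norm_num
      _ ≤ _ := pow_le_pow_right₀ (by norm_num) (by omega)
  have hPch : ((i + 4).choose 2 : ℝ) ≤ 2 ^ (i + 3) := by
    exact_mod_cast choose_two_le_two_pow (i + 3)
  rw [one_div, inv_pow] at hcount
  generalize (2 : ℝ) ^ (i + 3) = P at *
  have hcP : 3 * (i + 2) ≤ c := by nlinarith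
  have hcp : c ≤ p := by nlinarith
  have hp0 : 0 < p := by linarith
  have hD0 : 0 < D := by linarith
  have hkp : ((i : ℝ) + 2) / 2 * ((i + 2 + 1) / p) ≤ 1 / 4 := by
    rw [div_mul_div_comm, div_le_div_iff₀ (by positivity) (by norm_num)]
    nlinarith
  have hS' : S ≤ i / 2 + 9 / 4 := by linarith
  have hbr : b ≤ i + 4 := by
    have : (b : ℝ) < ((i + 5 : ℕ) : ℝ) := by push_cast; linarith
    have : b < i + 5 := by exact_mod_cast this
    omega
  have hch : (b.choose 2 : ℝ) ≤ P :=
    le_trans (by exact_mod_cast Nat.choose_le_choose 2 hbr) hPch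
  have h1 : N ≤ P * (D * S) + b.choose 2 * D := by
    have hP0 : 0 < P := by linarith
    have := mul_le_mul_of_nonneg_left hcount hP0.le
    calc N = P * (N * P⁻¹) := by field_simp
      _ ≤ _ := this
      _ = _ := by field_simp
  have h2 : P * (D * S) ≤ P * (D * (i / 2 + 9 / 4)) := by gcongr
  have h3 : (b.choose 2 : ℝ) * D ≤ P * D := by gcongr
  have h4 : c * D < D * (P * (i / 2 + 13 / 4)) := by linarith
  have h5 : c < P * (i / 2 + 13 / 4) := by
    rw [mul_comm] at h4
    exact lt_of_mul_lt_mul_left h4 hD0.le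
  nlinarith

/-! ### Assembly of the proof. -/

theorem theorem1p6 (r t m : ℕ) (hr : 4 ≤ r)
    (hm_lower : (t - 1).choose r ≤ m)
    (hm_upper : (m : ℤ) ≤ ((t - 1).choose r : ℤ) + ((t - 2).choose (r - 1) : ℤ)
      - ((2 * (r : ℤ) - 6) * 2 ^ (r - 1) + 2 ^ (r - 3) + ((r : ℤ) - 4) * (2 * (r : ℤ) - 7) - 1)
        * (((t - 2).choose (r - 2) : ℤ) - 1))
    {V : Type*} [Fintype V] (hV : Fintype.card V = t)
    (G : UniformHypergraph r V) (hG : G.edges.card = m)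
    (hclique : ¬ G.ContainsClique (t - 1)) :
    G.lagrangian < (UniformHypergraph.complete r (Fin (t - 1))).lagrangian := by
  classical
  -- Below r vertices every set is vacuously a clique.
  have hrt : r ≤ t - 1 := by
    by_contra! h
    obtain ⟨S, -, hS⟩ := exists_subset_card_eq (show t - 1 ≤ #(univ : Finset V) by
      rw [card_univ]; omega)
    refine hclique ⟨S, hS, fun e he hec => ?_⟩
    have := card_le_card he
    omega
  obtain ⟨i, rfl⟩ := Nat.exists_eq_add_of_le' hr
  -- p = t - r.
  obtain ⟨p, rfl⟩ : ∃ p, t = i + 2 + p + 2 := ⟨t - (i + 4), by omega⟩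
  have hp : 1 ≤ p := by omega
  simp only [show i + 2 + p + 2 - 1 = i + 2 + p + 1 by omega, Nat.add_sub_cancel,
    show i + 4 - 1 = i + 3 by omega, show i + 4 - 2 = i + 2 by omega,
    show i + 4 - 3 = i + 1 by omega] at hm_lower hm_upper hclique hrt ⊢
  have : Nonempty V := Fintype.card_pos_iff.mp (by omega)
  obtain ⟨x, hx, hxG⟩ := G.isGreatest_lagrangian.1
  have hmax : ∀ y ∈ stdSimplex ℝ V, G.weight y ≤ G.weight x := fun y hy =>
    hxG ▸ G.isGreatest_lagrangian.2 ⟨y, hy, rfl⟩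
  refine lt_of_lt_of_le ?_
    (UniformHypergraph.choose_div_pow_le_lagrangian_complete (Nat.succ_ne_zero _) (i + 4))
  rw [← hxG]
  by_cases hzero : ∃ v, x v = 0
  · obtain ⟨v, hv⟩ := hzero
    exact G.weight_lt_of_eq_zero (by omega) hrt hV hclique hx hv
  push Not at hzero
  by_contra! hL
  set f : V → ℝ := fun v =>
    1 - ((i + 2 + p + 1 : ℕ) : ℝ) / ((i + 2 : ℕ) + 1) * (1 - (1 - x v) ^ (i + 2 + 1)) with hf
  set N : Finset (Finset V) := powersetCard (i + 4) univ \ G.edges with hN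
  have hlink : ∀ v, ∑ e ∈ N with v ∈ e, ∏ u ∈ e.erase v, (((i + 2 + p + 1 : ℕ) : ℝ) * x u) ≤
      ((i + 2 + p).choose (i + 2) : ℝ) * f v := fun v =>
    G.nonedge_link_le hV hx hmax hL ((hx.1 v).lt_of_ne' (hzero v))
  have hD3 : i + 3 ≤ (i + 2 + p).choose (i + 2) := by
    refine le_trans ?_ (Nat.choose_le_choose (i + 2) (show i + 3 ≤ i + 2 + p by omega))
    rw [Nat.choose_succ_self_right]
  have hDp : p + 1 ≤ (i + 2 + p).choose (i + 2) := by
    rw [Nat.choose_symm_add]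
    refine le_trans ?_ (Nat.choose_le_choose p (show p + 1 ≤ i + 2 + p by omega))
    rw [Nat.choose_succ_self_right]
  have hDk : (i + 2 + p).choose (i + 3) * (i + 3) = (i + 2 + p).choose (i + 2) * p := by
    have := Nat.choose_succ_right_eq (i + 2 + p) (i + 2)
    rwa [Nat.add_sub_cancel_left] at this
  have hNcard : #N + m = (i + 2 + p + 1).choose (i + 4) +
      ((i + 2 + p).choose (i + 3) + (i + 2 + p).choose (i + 2)) := by
    have hE : G.edges ⊆ powersetCard (i + 4) univ := fun e he =>
      mem_powersetCard.mpr ⟨subset_univ e, G.card_of_mem e he⟩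
    have h1 := card_sdiff_add_card_eq_card hE
    rw [hG, card_powersetCard, card_univ, hV] at h1
    change #N + m = _ at h1
    have h2 : (i + 2 + p + 2).choose (i + 4) =
        (i + 2 + p + 1).choose (i + 3) + (i + 2 + p + 1).choose (i + 4) :=
      Nat.choose_succ_succ _ _
    have h3 : (i + 2 + p + 1).choose (i + 3) =
        (i + 2 + p).choose (i + 2) + (i + 2 + p).choose (i + 3) :=
      Nat.choose_succ_succ _ _
    omega
  set D : ℕ := (i + 2 + p).choose (i + 2) with hD
  have hf0 : ∀ v, 0 ≤ f v := fun v => by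
    have h0 : (0 : ℝ) ≤ D * f v := le_trans (sum_nonneg fun e _ => prod_nonneg fun u _ =>
      mul_nonneg (Nat.cast_nonneg _) (hx.1 u)) (hlink v)
    exact nonneg_of_mul_nonneg_right h0 (by exact_mod_cast (show 0 < D by omega))
  have hfy : ∀ v, 1 - f v ≤ ((i + 2 + p + 1 : ℕ) : ℝ) * x v := fun v => by
    have hxv : x v ≤ 1 := hx.2 ▸ single_le_sum (fun u _ => hx.1 u) (mem_univ v)
    have hB := one_add_mul_le_pow (show (-2 : ℝ) ≤ -x v by linarith) (i + 2 + 1)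
    have hk : 1 - (1 - x v) ^ (i + 2 + 1) ≤ ((i + 2 : ℕ) + 1 : ℝ) * x v := by
      rw [← sub_eq_add_neg] at hB
      push_cast at hB ⊢
      linarith
    calc 1 - f v = ((i + 2 + p + 1 : ℕ) : ℝ) / ((i + 2 : ℕ) + 1) *
          (1 - (1 - x v) ^ (i + 2 + 1)) := by rw [hf]; ring
      _ ≤ ((i + 2 + p + 1 : ℕ) : ℝ) / ((i + 2 : ℕ) + 1) * (((i + 2 : ℕ) + 1 : ℝ) * x v) := by
          gcongr
      _ = _ := by field_simp
  have hS := sum_defect_le hp hV hx hf0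
  change ∑ v, f v ≤ _ at hS
  have hbad : ∀ q : ℝ, (#{v | 1 - q < f v} : ℝ) * (1 - q) ≤ ∑ v, f v := fun q => by
    rw [← nsmul_eq_mul]
    refine (card_nsmul_le_sum _ _ _ fun v hv => (mem_filter.mp hv).2.le).trans ?_
    exact sum_le_sum_of_subset_of_nonneg (subset_univ _) fun v _ _ => hf0 v
  have hcount : ∀ q : ℝ, 0 ≤ q → (#N : ℝ) * q ^ (i + 3) ≤ D * ∑ v, f v + q ^ (i + 3) *
      ((#{v | 1 - q < f v}).choose 2 * D) := fun q hq => by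
    have h := card_le_of_link_le (show 2 ≤ i + 4 by omega) N
      (fun e he => (mem_powersetCard.mp (mem_sdiff.mp he).1).2) f _ hq
      (fun v => mul_nonneg (Nat.cast_nonneg _) (hx.1 v)) hfy hlink
    rw [hV, Nat.cast_mul] at h
    exact h
  -- c is the bracketed coefficient of the upper bound on m, with r = i + 4.
  obtain ⟨c, hc⟩ : ∃ c : ℤ, c = (2 * i + 2) * 2 ^ (i + 3) + 2 ^ (i + 1) + i * (2 * i + 1) - 1 :=
    ⟨_, rfl⟩
  have hm_upper' : (m : ℤ) ≤ (i + 2 + p + 1).choose (i + 4) + (i + 2 + p).choose (i + 3) -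
      c * (D - 1) := by
    rw [hc]
    refine hm_upper.trans_eq ?_
    push_cast
    ring
  have hNc : ((c : ℝ) + 1) * D - c ≤ #N := by
    have h : (c + 1) * D - c ≤ (#N : ℤ) := by
      have : (#N : ℤ) + m = (i + 2 + p + 1).choose (i + 4) +
        ((i + 2 + p).choose (i + 3) + D) := by exact_mod_cast hNcard
      linarith
    exact_mod_cast h
  have hcr : (c : ℝ) = (2 * i + 2) * 2 ^ (i + 3) + 2 ^ (i + 1) + i * (2 * i + 1) - 1 := by
    rw [hc]; push_cast; ring
  have hcD : (c : ℝ) * (D - 1) ≤ (i + 2 + p).choose (i + 3) := by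
    have h : c * (D - 1) ≤ ((i + 2 + p).choose (i + 3) : ℤ) := by
      have : ((i + 2 + p + 1).choose (i + 4) : ℤ) ≤ m := by exact_mod_cast hm_lower
      linarith
    exact_mod_cast h
  have hc0 : (0 : ℝ) ≤ c := by
    have h1 : (1 : ℝ) ≤ 2 ^ (i + 1) := one_le_pow₀ (by norm_num)
    have h2 : (0 : ℝ) ≤ (2 * i + 2) * 2 ^ (i + 3) + i * (2 * i + 1) := by positivity
    linarith
  have hDr : (p : ℝ) + 1 ≤ D := by exact_mod_cast hDp
  -- The two bounds on m are compatible only if c(D-1) ≤ C(t-2,r-1) = Dp/(r-1). This makes p large;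
  -- 2/3 comes from D - 1 ≥ 2D/3 for D ≥ 3.
  have hcp : 2 / 3 * (((i : ℝ) + 3) * c) ≤ p := by
    have h1 : ((i + 2 + p).choose (i + 3) : ℝ) * (i + 3) = D * p := by exact_mod_cast hDk
    have h2 : (3 : ℝ) ≤ D := by exact_mod_cast (show 3 ≤ D by omega)
    have h3 : (c : ℝ) * (D - 1) * (i + 3) ≤ D * p := by
      rw [← h1]; gcongr
    have h4 : (c : ℝ) * (2 / 3 * D) * (i + 3) ≤ c * (D - 1) * (i + 3) := by
      gcongr; linarith
    have h5 : (D : ℝ) * (2 / 3 * ((i + 3) * c)) ≤ D * p := by linarith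
    exact le_of_mul_le_mul_left h5 (by linarith)
  push_cast at hS
  rcases Nat.eq_zero_or_pos i with rfl | hi
  · norm_num at hcr
    rw [hcr] at hcp hNc
    refine numeric_contradiction_four (p := p) (S := ∑ v, f v) ?_ hDr ?_ ?_
      (hcount (4 / 7) (by norm_num)) hNc
    · norm_num at hcp ⊢; exact hcp
    · simpa using hS
    · have := hbad (4 / 7); norm_num at this ⊢; exact this
  · refine numeric_contradiction_of_five_le (S := ∑ v, f v) hi ?_ hcp hDr hS ?_
      (hcount (1 / 2) (by norm_num)) hNc
    · have : (0 : ℝ) ≤ 2 ^ (i + 1) + i * (2 * i + 1) := by positivity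
      linarith
    · have := hbad (1 / 2); norm_num at this ⊢; exact this
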